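/- Let $d\ge 1$ be an integer, $p,q\in(1,\infty)$ and $A,B\in(0,\infty)$. Write $\kappa_r=\frac{r-1}{r}$, $\mathrm{Log}_-(x)=\max\{-\log x,0\}$ for $x>0$, and $$G(s)=\int_0^s e^{-(d!\,\tau)^{1/d}}\,d\tau\qquad(s\ge 0).$$ Assume that $$\kappa_q^{d\left(\frac1q-\frac1p\right)}\left(\frac pq\right)^{\frac dp}<\frac BA<\kappa_p^{d\left(\frac1q-\frac1p\right)}\left(\frac pq\right)^{\frac dq}.$$ Let $\mathcal C$ be the set of nonincreasing functions $v:(0,\infty)\to[0,\infty)$ such that $$p\int_0^\infty t^{p-1}v(t)\,dt\le A^p\quad\text{and}\quad q\int_0^\infty t^{q-1}v(t)\,dt\le B^q,$$ and let $I(v)=\int_0^\infty G(v(t))\,dt$ for $v\in\mathcal C$. Then $\sup_{v\in\mathcal C}I(v)$ is finite, and there is exactly one function $u\in\mathcal C$ with $I(u)=\sup_{v\in\mathcal C}I(v)$. It is given by $$u(t)=\frac1{d!}\left[\mathrm{Log}_-\left(\lambda_1t^{p-1}+\lambda_2t^{q-1}\right)\right]^d,\qquad t>0,$$ where $(\lambda_1,\lambda_2)$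 is the unique pair of positive real numbers for which this $u$ satisfies $$p\int_0^\infty t^{p-1}u(t)\,dt=A^p,\qquad q\int_0^\infty t^{q-1}u(t)\,dt=B^q.$$ -/

import Mathlib

open MeasureTheory
open scoped ENNReal

namespace TwoConstraint

/-- `κ_r = (r - 1) / r`. -/
noncomputable def kappa (r : ℝ) : ℝ := (r - 1) / r

/-- `Log_-(x) = max {-log x, 0}` (used at `x > 0` only). -/
noncomputable def logMinus (x : ℝ) : ℝ := max (-Real.log x) 0

/-- `G(s) = ∫₀ˢ exp (-(d! τ)^{1/d}) dτ` (used at `s ≥ 0` only). -/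
noncomputable def G (d : ℕ) (s : ℝ) : ℝ :=
  ∫ τ in (0 : ℝ)..s, Real.exp (-(((d.factorial : ℝ) * τ) ^ ((1 : ℝ) / (d : ℝ))))

/-- The intermediate regime
`κ_q^{d(1/q-1/p)} (p/q)^{d/p} < B/A < κ_p^{d(1/q-1/p)} (p/q)^{d/q}`. -/
def IntermediateRegime (d : ℕ) (p q A B : ℝ) : Prop :=
  kappa q ^ ((d : ℝ) * (1 / q - 1 / p)) * (p / q) ^ ((d : ℝ) / p) < B / A ∧
    B / A < kappa p ^ ((d : ℝ) * (1 / q - 1 / p)) * (p / q) ^ ((d : ℝ) / q)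

/-- `r ∫₀^∞ t^{r-1} v(t) dt`, as an element of `[0, ∞]`, for `v` nonnegative on `(0, ∞)`. -/
noncomputable def moment (r : ℝ) (v : ℝ → ℝ) : ℝ≥0∞ :=
  ENNReal.ofReal r * ∫⁻ t in Set.Ioi (0 : ℝ), ENNReal.ofReal (t ^ (r - 1) * v t)

/-- The class of nonincreasing `v : (0, ∞) → [0, ∞)` with `p ∫ t^{p-1} v ≤ A^p` and
`q ∫ t^{q-1} v ≤ B^q`. A function on `(0, ∞)` is given as a function on `ℝ`, of which only the
restriction to `(0, ∞)` matters. -/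
def admissible (p q A B : ℝ) : Set (ℝ → ℝ) :=
  {v | (∀ t ∈ Set.Ioi (0 : ℝ), 0 ≤ v t) ∧ AntitoneOn v (Set.Ioi 0) ∧
    moment p v ≤ ENNReal.ofReal (A ^ p) ∧ moment q v ≤ ENNReal.ofReal (B ^ q)}

/-- `I(v) = ∫₀^∞ G(v(t)) dt`, as an element of `[0, ∞]`. -/
noncomputable def I (d : ℕ) (v : ℝ → ℝ) : ℝ≥0∞ :=
  ∫⁻ t in Set.Ioi (0 : ℝ), ENNReal.ofReal (G d (v t))

/-- `v` attains the supremum of `I` over the admissible class. -/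
def IsMaximizer (d : ℕ) (p q A B : ℝ) (v : ℝ → ℝ) : Prop :=
  v ∈ admissible p q A B ∧ I d v = ⨆ w ∈ admissible p q A B, I d w

/-- `t ↦ (1/d!) [Log_-(l₁ t^{p-1} + l₂ t^{q-1})]^d`. -/
noncomputable def profile (d : ℕ) (p q l₁ l₂ : ℝ) (t : ℝ) : ℝ :=
  1 / (d.factorial : ℝ) * logMinus (l₁ * t ^ (p - 1) + l₂ * t ^ (q - 1)) ^ d

/-- Both constraints hold with equality for `v`. -/
def SaturatesConstraints (p q A B : ℝ) (v : ℝ → ℝ) : Prop :=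
  moment p v = ENNReal.ofReal (A ^ p) ∧ moment q v = ENNReal.ofReal (B ^ q)

end TwoConstraint

namespace TwoConstraint

/-! This is Lagrangian duality for a concave problem. `G` is strictly concave on [0, ∞), so with
L(t) = l₁ t^(p-1) + l₂ t^(q-1) the function s ↦ G(s) - L(t)s has a unique maximizer over s ≥ 0, the
profile at t (`G_add_lt_of_ne_profile`). If the profile saturates both constraints, every admissible
v has ∫ L v ≤ ∫ L u; integrating the pointwise inequality gives I(v) ≤ I(u), and equality forces v =
u a.e., hence everywhere by monotonicity of v and continuity of u.

Multipliers exist by scaling and continuity (`exists_saturating_profile`). Up to dilation the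
multipliers are (1 - θ, θ). The dilation-invariant ratio of the q-th and p-th norms is continuous in
θ, and its values at θ = 0, 1 are exactly the two bounds of the regime, so some interior θ gives
B/A; a dilation then fixes the size. Multipliers are unique because any saturating profile is a
maximizer, hence the same function, and the function determines its coefficients
(`eq_of_eqOn_profile`). -/

open Set Filter Topology

/-! ### Strict concavity of `G` -/

/-- The integrand `exp (-(d! τ)^{1/d})` in the definition of `G`. -/
noncomputable def density (d : ℕ) (τ : ℝ) : ℝ :=
  Real.exp (-(((d.factorial : ℝ) * τ) ^ ((1 : ℝ) / (d : ℝ))))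

lemma continuous_density (d : ℕ) : Continuous (density d) := by
  unfold density
  have h : Continuous fun τ : ℝ => ((d.factorial : ℝ) * τ) ^ ((1 : ℝ) / (d : ℝ)) :=
    (continuous_const.mul continuous_id).rpow_const fun _ => Or.inr (by positivity)
  fun_prop

lemma density_strictAntiOn {d : ℕ} (hd : 1 ≤ d) : StrictAntiOn (density d) (Ici 0) := by
  intro a ha b hb hab
  have hf : (0 : ℝ) < d.factorial := by positivity
  have hd' : (0 : ℝ) < d := by exact_mod_cast hd
  simp only [mem_Ici] at ha
  unfold density
  rw [Real.exp_lt_exp, neg_lt_neg_iff]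
  exact Real.rpow_lt_rpow (by positivity) (by gcongr) (by positivity)

lemma density_zero {d : ℕ} (hd : 1 ≤ d) : density d 0 = 1 := by
  have hd' : (d : ℝ) ≠ 0 := by positivity
  simp [density, Real.zero_rpow, hd']

lemma hasDerivAt_G (d : ℕ) (s : ℝ) : HasDerivAt (G d) (density d s) s :=
  intervalIntegral.integral_hasDerivAt_right
    ((continuous_density d).intervalIntegrable _ _)
    (continuous_density d).stronglyMeasurable.stronglyMeasurableAtFilter
    (continuous_density d).continuousAt

lemma continuous_G (d : ℕ) : Continuous (G d) :=
  continuous_iff_continuousAt.2 fun s => (hasDerivAt_G d s).continuousAt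

lemma G_zero (d : ℕ) : G d 0 = 0 := by simp [G]

lemma G_nonneg (d : ℕ) {s : ℝ} (hs : 0 ≤ s) : 0 ≤ G d s :=
  intervalIntegral.integral_nonneg hs fun _ _ => (Real.exp_pos _).le

/-- By the mean value theorem the chord slope is the density at an interior point, and the density
is strictly decreasing. -/
lemma G_lt_tangent {d : ℕ} (hd : 1 ≤ d) {a s : ℝ} (ha : 0 ≤ a) (hs : 0 ≤ s) (h : s ≠ a) :
    G d s < G d a + density d a * (s - a) := by
  rcases lt_or_gt_of_ne h with h | h
  · obtain ⟨c, hc, e⟩ := exists_hasDerivAt_eq_slope (G d) (density d) h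
      (continuous_G d).continuousOn fun x _ => hasDerivAt_G d x
    rw [eq_div_iff (by linarith)] at e
    have := density_strictAntiOn hd (hs.trans hc.1.le) ha hc.2
    nlinarith [hc.1, hc.2]
  · obtain ⟨c, hc, e⟩ := exists_hasDerivAt_eq_slope (G d) (density d) h
      (continuous_G d).continuousOn fun x _ => hasDerivAt_G d x
    rw [eq_div_iff (by linarith)] at e
    have := density_strictAntiOn hd ha (ha.trans hc.1.le) hc.1
    nlinarith [hc.1, hc.2]

/-! ### The profile as pointwise maximizer -/

lemma logMinus_nonneg (x : ℝ) : 0 ≤ logMinus x := le_max_right _ _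

lemma logMinus_of_one_le {x : ℝ} (hx : 1 ≤ x) : logMinus x = 0 :=
  max_eq_right (neg_nonpos.2 (Real.log_nonneg hx))

lemma logMinus_of_le_one {x : ℝ} (h0 : 0 ≤ x) (hx : x ≤ 1) : logMinus x = -Real.log x :=
  max_eq_left (neg_nonneg.2 (Real.log_nonpos h0 hx))

lemma logMinus_le_logMinus {x y : ℝ} (hx : 0 < x) (h : x ≤ y) : logMinus y ≤ logMinus x :=
  max_le_max (neg_le_neg (Real.log_le_log hx h)) le_rfl

/-- The factor 1/d! and the d-th power invert the density, so the slope of `G` at the profile is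
min(L, 1). -/
lemma density_div_factorial_pow {d : ℕ} (hd : 1 ≤ d) {x : ℝ} (hx : 0 ≤ x) :
    density d (1 / (d.factorial : ℝ) * x ^ d) = Real.exp (-x) := by
  have hf : (d.factorial : ℝ) ≠ 0 := by positivity
  rw [density, ← mul_assoc, mul_one_div_cancel hf, one_mul, one_div,
    Real.pow_rpow_inv_natCast hx (by omega)]

section Profile

variable {d : ℕ} {p q l₁ l₂ : ℝ}

lemma profile_nonneg (t : ℝ) : 0 ≤ profile d p q l₁ l₂ t :=
  mul_nonneg (by positivity) (pow_nonneg (logMinus_nonneg _) _)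

lemma combination_pos (h₁ : 0 < l₁) (h₂ : 0 < l₂) {t : ℝ} (ht : 0 < t) :
    0 < l₁ * t ^ (p - 1) + l₂ * t ^ (q - 1) := by positivity

lemma continuous_combination (hp : 1 < p) (hq : 1 < q) :
    Continuous fun t : ℝ => l₁ * t ^ (p - 1) + l₂ * t ^ (q - 1) :=
  (continuous_const.mul (continuous_id.rpow_const fun _ => Or.inr (by linarith))).add
    (continuous_const.mul (continuous_id.rpow_const fun _ => Or.inr (by linarith)))

lemma measurable_profile : Measurable (profile d p q l₁ l₂) := by
  unfold profile logMinus
  fun_prop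

lemma profile_antitoneOn (hp : 1 < p) (hq : 1 < q) (h₁ : 0 < l₁) (h₂ : 0 < l₂) :
    AntitoneOn (profile d p q l₁ l₂) (Ioi 0) := by
  intro a ha b hb hab
  simp only [mem_Ioi] at ha hb
  have hp' : 0 ≤ p - 1 := by linarith
  have hq' : 0 ≤ q - 1 := by linarith
  unfold profile
  gcongr
  · exact logMinus_nonneg _
  · exact logMinus_le_logMinus (combination_pos h₁ h₂ ha) (by gcongr)

lemma continuousOn_profile (hp : 1 < p) (hq : 1 < q) (h₁ : 0 < l₁) (h₂ : 0 < l₂) :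
    ContinuousOn (profile d p q l₁ l₂) (Ioi 0) := by
  unfold profile logMinus
  have h : ContinuousOn (fun t : ℝ => Real.log (l₁ * t ^ (p - 1) + l₂ * t ^ (q - 1))) (Ioi 0) :=
    (continuous_combination hp hq).continuousOn.log fun t ht => (combination_pos h₁ h₂ ht).ne'
  exact continuousOn_const.mul ((h.neg.sup continuousOn_const).pow d)

/-- The profile maximizes `s ↦ G s - (l₁ t^{p-1} + l₂ t^{q-1}) s` at each `t > 0`. -/
lemma G_add_lt_of_ne_profile (hd : 1 ≤ d) (h₁ : 0 < l₁) (h₂ : 0 < l₂) {t s : ℝ}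
    (ht : 0 < t) (hs : 0 ≤ s) (hne : s ≠ profile d p q l₁ l₂ t) :
    G d s + (l₁ * t ^ (p - 1) + l₂ * t ^ (q - 1)) * profile d p q l₁ l₂ t <
      G d (profile d p q l₁ l₂ t) + (l₁ * t ^ (p - 1) + l₂ * t ^ (q - 1)) * s := by
  have hlt := G_lt_tangent hd (profile_nonneg t) hs hne
  have hpos := combination_pos (p := p) (q := q) h₁ h₂ ht
  have hdens : density d (profile d p q l₁ l₂ t) =
      Real.exp (-logMinus (l₁ * t ^ (p - 1) + l₂ * t ^ (q - 1))) :=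
    density_div_factorial_pow hd (logMinus_nonneg _)
  rcases le_total (l₁ * t ^ (p - 1) + l₂ * t ^ (q - 1)) 1 with hL | hL
  · rw [hdens, logMinus_of_le_one hpos.le hL, neg_neg, Real.exp_log hpos] at hlt
    linarith
  -- Here the maximum sits at the boundary s = 0, where `G` has slope 1 ≤ L.
  · have h0 : profile d p q l₁ l₂ t = 0 := by
      rw [profile, logMinus_of_one_le hL, zero_pow (by omega), mul_zero]
    rw [h0, density_zero hd] at hlt
    rw [h0]
    nlinarith

/-- Written with sums on both sides so that it passes to `ENNReal` without truncated subtraction. -/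
lemma G_add_le_profile (hd : 1 ≤ d) (h₁ : 0 < l₁) (h₂ : 0 < l₂) {t s : ℝ}
    (ht : 0 < t) (hs : 0 ≤ s) :
    G d s + (l₁ * t ^ (p - 1) + l₂ * t ^ (q - 1)) * profile d p q l₁ l₂ t ≤
      G d (profile d p q l₁ l₂ t) + (l₁ * t ^ (p - 1) + l₂ * t ^ (q - 1)) * s := by
  rcases eq_or_ne s (profile d p q l₁ l₂ t) with h | h
  · rw [h]
  · exact (G_add_lt_of_ne_profile hd h₁ h₂ ht hs h).le

end Profile

/-! ### Integrated comparison and uniqueness of the maximizer -/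

lemma aemeasurable_weight_mul {v : ℝ → ℝ} (hv : AntitoneOn v (Ioi 0)) (r : ℝ) :
    AEMeasurable (fun t => t ^ (r - 1) * v t) (volume.restrict (Ioi 0)) :=
  (by fun_prop : Measurable fun t : ℝ => t ^ (r - 1)).aemeasurable.mul
    (aemeasurable_restrict_of_antitoneOn measurableSet_Ioi hv)

lemma lintegral_combination_mul {v : ℝ → ℝ} (hv : AntitoneOn v (Ioi 0))
    (h0 : ∀ t ∈ Ioi (0 : ℝ), 0 ≤ v t) {p q l₁ l₂ : ℝ} (h₁ : 0 < l₁) (h₂ : 0 < l₂) :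
    ∫⁻ t in Ioi (0 : ℝ), ENNReal.ofReal ((l₁ * t ^ (p - 1) + l₂ * t ^ (q - 1)) * v t) =
      ENNReal.ofReal l₁ * (∫⁻ t in Ioi (0 : ℝ), ENNReal.ofReal (t ^ (p - 1) * v t)) +
      ENNReal.ofReal l₂ * ∫⁻ t in Ioi (0 : ℝ), ENNReal.ofReal (t ^ (q - 1) * v t) := by
  have hm := fun r => (aemeasurable_weight_mul hv r).ennreal_ofReal
  rw [← lintegral_const_mul'' _ (hm p), ← lintegral_const_mul'' _ (hm q),
    ← lintegral_add_left' ((hm p).const_mul _)]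
  refine setLIntegral_congr_fun measurableSet_Ioi fun t ht => ?_
  have hv0 := h0 t ht
  have ht' : 0 < t := ht
  rw [← ENNReal.ofReal_mul h₁.le, ← ENNReal.ofReal_mul h₂.le,
    ← ENNReal.ofReal_add (by positivity) (by positivity)]
  congr 1
  ring

/-- A nonincreasing function that agrees a.e. with a continuous one agrees with it everywhere. -/
lemma AntitoneOn.eqOn_of_ae_eq {u v : ℝ → ℝ} (hv : AntitoneOn v (Ioi 0))
    (hu : ContinuousOn u (Ioi 0)) (h : ∀ᵐ t ∂volume.restrict (Ioi (0 : ℝ)), v t = u t) :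
    EqOn v u (Ioi 0) := by
  intro t ht
  have ht' : 0 < t := ht
  have hcont : ContinuousAt u t := hu.continuousAt (Ioi_mem_nhds ht)
  -- Agreement points are dense, since intervals have positive measure; those just left and right of
  -- t squeeze v(t).
  have key : ∀ a b : ℝ, 0 ≤ a → a < b → ∃ s ∈ Ioo a b, v s = u s := by
    intro a b ha hab
    by_contra! hcon
    rw [ae_restrict_iff' measurableSet_Ioi] at h
    have hz : volume (Ioo a b) = 0 :=
      measure_mono_null (fun s hs (hs' : s ∈ Ioi 0 → _) => hcon s hs (hs' (ha.trans_lt hs.1)))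
        (ae_iff.1 h)
    rw [Real.volume_Ioo, ENNReal.ofReal_eq_zero] at hz
    linarith
  refine le_antisymm (le_of_forall_pos_le_add fun ε hε => ?_)
    (le_of_forall_pos_le_add fun ε hε => ?_) <;>
  obtain ⟨δ, hδ, hδ'⟩ := Metric.continuousAt_iff.1 hcont ε hε
  · obtain ⟨s, hs, e⟩ := key (max 0 (t - δ)) t (le_max_left _ _) (max_lt ht' (by linarith))
    have h1 := (max_lt_iff.1 hs.1)
    have h2 := hδ' (x := s) (by rw [Real.dist_eq, abs_lt]; constructor <;> linarith [hs.2])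
    rw [Real.dist_eq, abs_lt] at h2
    have h3 := hv h1.1 ht hs.2.le
    linarith
  · obtain ⟨s, hs, e⟩ := key t (t + δ) ht'.le (by linarith)
    have h2 := hδ' (x := s) (by rw [Real.dist_eq, abs_lt]; constructor <;> linarith [hs.1, hs.2])
    rw [Real.dist_eq, abs_lt] at h2
    have h3 := hv ht (ht'.trans hs.1) hs.1.le
    linarith

section Optimality

variable {d : ℕ} {p q A B l₁ l₂ : ℝ}

lemma profile_mem_admissible (hp : 1 < p) (hq : 1 < q) (h₁ : 0 < l₁) (h₂ : 0 < l₂)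
    (hs : SaturatesConstraints p q A B (profile d p q l₁ l₂)) :
    profile d p q l₁ l₂ ∈ admissible p q A B :=
  ⟨fun t _ => profile_nonneg t, profile_antitoneOn hp hq h₁ h₂, hs.1.le, hs.2.le⟩

lemma weightedIntegral_le_of_moment_le {r : ℝ} (hr : 0 < r) {u v : ℝ → ℝ}
    (h : moment r v ≤ moment r u) :
    ∫⁻ t in Ioi (0 : ℝ), ENNReal.ofReal (t ^ (r - 1) * v t) ≤
      ∫⁻ t in Ioi (0 : ℝ), ENNReal.ofReal (t ^ (r - 1) * u t) :=
  (ENNReal.mul_le_mul_iff_right (ENNReal.ofReal_pos.2 hr).ne' ENNReal.ofReal_ne_top).1 h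

lemma weightedIntegral_ne_top {r : ℝ} (hr : 0 < r) {u : ℝ → ℝ} (h : moment r u ≠ ⊤) :
    ∫⁻ t in Ioi (0 : ℝ), ENNReal.ofReal (t ^ (r - 1) * u t) ≠ ⊤ := by
  intro e
  exact h (by rw [moment, e, ENNReal.mul_top (ENNReal.ofReal_pos.2 hr).ne'])

lemma ofReal_G_add_le_profile_ae (hd : 1 ≤ d) (h₁ : 0 < l₁) (h₂ : 0 < l₂)
    {v : ℝ → ℝ} (h0 : ∀ t ∈ Ioi (0 : ℝ), 0 ≤ v t) :
    ∀ᵐ t ∂volume.restrict (Ioi (0 : ℝ)),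
      ENNReal.ofReal (G d (v t)) + ENNReal.ofReal ((l₁ * t ^ (p - 1) + l₂ * t ^ (q - 1)) *
        profile d p q l₁ l₂ t) ≤
      ENNReal.ofReal (G d (profile d p q l₁ l₂ t)) +
        ENNReal.ofReal ((l₁ * t ^ (p - 1) + l₂ * t ^ (q - 1)) * v t) := by
  filter_upwards [ae_restrict_mem measurableSet_Ioi] with t ht
  have hpos := (combination_pos (p := p) (q := q) h₁ h₂ ht).le
  rw [← ENNReal.ofReal_add (G_nonneg d (h0 t ht)) (mul_nonneg hpos (profile_nonneg t)),
    ← ENNReal.ofReal_add (G_nonneg d (profile_nonneg t)) (mul_nonneg hpos (h0 t ht))]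
  exact ENNReal.ofReal_le_ofReal (G_add_le_profile hd h₁ h₂ ht (h0 t ht))

lemma aemeasurable_G_comp {v : ℝ → ℝ} (hv : AntitoneOn v (Ioi 0)) :
    AEMeasurable (fun t => ENNReal.ofReal (G d (v t))) (volume.restrict (Ioi 0)) :=
  ((continuous_G d).measurable.comp_aemeasurable
    (aemeasurable_restrict_of_antitoneOn measurableSet_Ioi hv)).ennreal_ofReal

lemma aemeasurable_combination_mul {v : ℝ → ℝ} (hv : AntitoneOn v (Ioi 0)) :
    AEMeasurable (fun t => ENNReal.ofReal ((l₁ * t ^ (p - 1) + l₂ * t ^ (q - 1)) * v t))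
      (volume.restrict (Ioi 0)) :=
  ((by fun_prop : Measurable fun t : ℝ => l₁ * t ^ (p - 1) + l₂ * t ^ (q - 1)).aemeasurable.mul
    (aemeasurable_restrict_of_antitoneOn measurableSet_Ioi hv)).ennreal_ofReal

lemma lintegral_combination_mul_le (hp : 1 < p) (hq : 1 < q) (h₁ : 0 < l₁) (h₂ : 0 < l₂)
    (hs : SaturatesConstraints p q A B (profile d p q l₁ l₂))
    {v : ℝ → ℝ} (hv : v ∈ admissible p q A B) :
    ∫⁻ t in Ioi (0 : ℝ), ENNReal.ofReal ((l₁ * t ^ (p - 1) + l₂ * t ^ (q - 1)) * v t) ≤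
    ∫⁻ t in Ioi (0 : ℝ), ENNReal.ofReal ((l₁ * t ^ (p - 1) + l₂ * t ^ (q - 1)) *
      profile d p q l₁ l₂ t) := by
  rw [lintegral_combination_mul hv.2.1 hv.1 h₁ h₂,
    lintegral_combination_mul (profile_antitoneOn hp hq h₁ h₂) (fun t _ => profile_nonneg t) h₁ h₂]
  exact add_le_add
    (mul_le_mul_right
      (weightedIntegral_le_of_moment_le (by linarith) (hv.2.2.1.trans hs.1.ge)) _)
    (mul_le_mul_right
      (weightedIntegral_le_of_moment_le (by linarith) (hv.2.2.2.trans hs.2.ge)) _)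

lemma lintegral_combination_mul_profile_ne_top (hp : 1 < p) (hq : 1 < q) (h₁ : 0 < l₁)
    (h₂ : 0 < l₂) (hs : SaturatesConstraints p q A B (profile d p q l₁ l₂)) :
    ∫⁻ t in Ioi (0 : ℝ), ENNReal.ofReal ((l₁ * t ^ (p - 1) + l₂ * t ^ (q - 1)) *
      profile d p q l₁ l₂ t) ≠ ⊤ := by
  rw [lintegral_combination_mul (profile_antitoneOn hp hq h₁ h₂) (fun t _ => profile_nonneg t)
    h₁ h₂]
  exact ENNReal.add_ne_top.2
    ⟨ENNReal.mul_ne_top ENNReal.ofReal_ne_top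
      (weightedIntegral_ne_top (by linarith) (hs.1.trans_ne ENNReal.ofReal_ne_top)),
    ENNReal.mul_ne_top ENNReal.ofReal_ne_top
      (weightedIntegral_ne_top (by linarith) (hs.2.trans_ne ENNReal.ofReal_ne_top))⟩

lemma I_le_I_profile (hd : 1 ≤ d) (hp : 1 < p) (hq : 1 < q) (h₁ : 0 < l₁) (h₂ : 0 < l₂)
    (hs : SaturatesConstraints p q A B (profile d p q l₁ l₂))
    {v : ℝ → ℝ} (hv : v ∈ admissible p q A B) : I d v ≤ I d (profile d p q l₁ l₂) := by
  have hu := profile_antitoneOn (d := d) hp hq h₁ h₂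
  have h := lintegral_mono_ae (ofReal_G_add_le_profile_ae (p := p) (q := q) hd h₁ h₂ hv.1)
  rw [lintegral_add_left' (aemeasurable_G_comp hv.2.1), lintegral_add_left'
    (aemeasurable_G_comp hu)] at h
  -- Cancelling ∫ L u requires it to be finite.
  exact (ENNReal.add_le_add_iff_right
    (lintegral_combination_mul_profile_ne_top hp hq h₁ h₂ hs)).1
    (h.trans (add_le_add_right (lintegral_combination_mul_le hp hq h₁ h₂ hs hv) _))

lemma isMaximizer_profile (hd : 1 ≤ d) (hp : 1 < p) (hq : 1 < q) (h₁ : 0 < l₁) (h₂ : 0 < l₂)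
    (hs : SaturatesConstraints p q A B (profile d p q l₁ l₂)) :
    IsMaximizer d p q A B (profile d p q l₁ l₂) :=
  have hu := profile_mem_admissible hp hq h₁ h₂ hs
  ⟨hu, le_antisymm (le_iSup₂_of_le _ hu le_rfl)
    (iSup₂_le fun _ hv => I_le_I_profile hd hp hq h₁ h₂ hs hv)⟩

lemma IsMaximizer.eqOn_profile (hd : 1 ≤ d) (hp : 1 < p) (hq : 1 < q) (h₁ : 0 < l₁) (h₂ : 0 < l₂)
    (hs : SaturatesConstraints p q A B (profile d p q l₁ l₂))
    (hfin : (⨆ w ∈ admissible p q A B, I d w) ≠ ⊤)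
    {v : ℝ → ℝ} (hv : IsMaximizer d p q A B v) : EqOn v (profile d p q l₁ l₂) (Ioi 0) := by
  have hu := profile_antitoneOn (d := d) hp hq h₁ h₂
  have hI : I d (profile d p q l₁ l₂) = I d v :=
    (isMaximizer_profile hd hp hq h₁ h₂ hs).2.trans hv.2.symm
  have hle := ofReal_G_add_le_profile_ae (p := p) (q := q) hd h₁ h₂ hv.1.1
  -- Since I(u) = I(v) and ∫ L v ≤ ∫ L u, the integrals compare in the reverse direction, so the
  -- pointwise inequality is an a.e. equality.
  have hae := ae_eq_of_ae_le_of_lintegral_le hle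
    (by
      rw [lintegral_add_left' (aemeasurable_G_comp hv.1.2.1)]
      exact ENNReal.add_ne_top.2 ⟨hv.2.trans_ne hfin,
        lintegral_combination_mul_profile_ne_top hp hq h₁ h₂ hs⟩)
    ((aemeasurable_G_comp hu).add (aemeasurable_combination_mul hv.1.2.1))
    (by
      rw [lintegral_add_left' (aemeasurable_G_comp hv.1.2.1),
        lintegral_add_left' (aemeasurable_G_comp hu)]
      exact add_le_add hI.le (lintegral_combination_mul_le hp hq h₁ h₂ hs hv.1))
  refine AntitoneOn.eqOn_of_ae_eq hv.1.2.1 (continuousOn_profile hp hq h₁ h₂) ?_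
  filter_upwards [hae, ae_restrict_mem measurableSet_Ioi] with t e ht
  by_contra hne
  have hpos := (combination_pos (p := p) (q := q) h₁ h₂ ht).le
  have h0 := hv.1.1 t ht
  rw [← ENNReal.ofReal_add (G_nonneg d h0) (mul_nonneg hpos (profile_nonneg t)),
    ← ENNReal.ofReal_add (G_nonneg d (profile_nonneg t)) (mul_nonneg hpos h0),
    ENNReal.ofReal_eq_ofReal_iff
      (add_nonneg (G_nonneg d h0) (mul_nonneg hpos (profile_nonneg t)))
      (add_nonneg (G_nonneg d (profile_nonneg t)) (mul_nonneg hpos h0))] at e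
  exact (G_add_lt_of_ne_profile hd h₁ h₂ ht h0 hne).ne e

lemma moment_congr {r : ℝ} {u v : ℝ → ℝ} (h : EqOn u v (Ioi 0)) : moment r u = moment r v := by
  unfold moment
  congr 1
  exact setLIntegral_congr_fun measurableSet_Ioi fun t ht => by simp only [h ht]

lemma I_congr {u v : ℝ → ℝ} (h : EqOn u v (Ioi 0)) : I d u = I d v :=
  setLIntegral_congr_fun measurableSet_Ioi fun t ht => by simp only [h ht]

lemma IsMaximizer.congr {u v : ℝ → ℝ} (hv : IsMaximizer d p q A B v) (h : EqOn u v (Ioi 0)) :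
    IsMaximizer d p q A B u :=
  ⟨⟨fun t ht => (h ht).symm ▸ hv.1.1 t ht, hv.1.2.1.congr h.symm,
    (moment_congr h).trans_le hv.1.2.2.1, (moment_congr h).trans_le hv.1.2.2.2⟩,
    (I_congr h).trans hv.2⟩

end Optimality

/-- Near 0 both combinations are below 1, where Log_- is injective. Dividing by t^(p-1) leaves an
affine relation in t^(q-p), and two sample points kill its coefficients because p ≠ q. -/
lemma eq_of_eqOn_profile {d : ℕ} (hd : 1 ≤ d) {p q l₁ l₂ m₁ m₂ : ℝ} (hp : 1 < p) (hq : 1 < q)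
    (hpq : p ≠ q) (hl₁ : 0 < l₁) (hl₂ : 0 < l₂) (hm₁ : 0 < m₁) (hm₂ : 0 < m₂)
    (h : EqOn (profile d p q m₁ m₂) (profile d p q l₁ l₂) (Ioi 0)) : m₁ = l₁ ∧ m₂ = l₂ := by
  have small : ∀ c₁ c₂ : ℝ, ∀ᶠ t in 𝓝 (0 : ℝ), c₁ * t ^ (p - 1) + c₂ * t ^ (q - 1) < 1 := by
    intro c₁ c₂
    refine (continuous_combination hp hq).continuousAt.eventually_lt continuousAt_const ?_
    rw [Real.zero_rpow (by linarith), Real.zero_rpow (by linarith)]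
    norm_num
  obtain ⟨δ, hδ, hsmall⟩ := Metric.eventually_nhds_iff.1 ((small l₁ l₂).and (small m₁ m₂))
  have hf : (1 / (d.factorial : ℝ)) ≠ 0 := by positivity
  have key : ∀ t, 0 < t → t < δ → (m₁ - l₁) + (m₂ - l₂) * t ^ (q - p) = 0 := by
    intro t ht htδ
    obtain ⟨h1, h2⟩ := hsmall (y := t) (by rw [Real.dist_eq, sub_zero, abs_of_pos ht]; exact htδ)
    have e := mul_left_cancel₀ hf (h ht)
    have e := (pow_left_inj₀ (logMinus_nonneg _) (logMinus_nonneg _) (by omega)).1 e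
    have p1 := combination_pos (p := p) (q := q) hl₁ hl₂ ht
    have p2 := combination_pos (p := p) (q := q) hm₁ hm₂ ht
    rw [logMinus_of_le_one p2.le h2.le, logMinus_of_le_one p1.le h1.le, neg_inj] at e
    have e := Real.log_injOn_pos p2 p1 e
    have hsplit : t ^ (q - 1) = t ^ (p - 1) * t ^ (q - p) := by
      rw [← Real.rpow_add ht]; congr 1; ring
    rw [hsplit] at e
    refine (mul_eq_zero.1 (?_ : t ^ (p - 1) * _ = 0)).resolve_left (by positivity)
    linear_combination e
  have k1 := key (δ / 2) (by linarith) (by linarith)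
  have k2 := key (δ / 3) (by linarith) (by linarith)
  have hne : (δ / 2) ^ (q - p) ≠ (δ / 3) ^ (q - p) := by
    intro e
    have := (Real.rpow_left_inj (by positivity) (by positivity) (sub_ne_zero.2 hpq.symm)).1 e
    linarith
  have hz : (m₂ - l₂) * ((δ / 2) ^ (q - p) - (δ / 3) ^ (q - p)) = 0 := by linear_combination k1 - k2
  have h2 := (mul_eq_zero.1 hz).resolve_right (sub_ne_zero.2 hne)
  rw [h2, zero_mul, add_zero] at k1
  exact ⟨sub_eq_zero.1 k1, sub_eq_zero.1 h2⟩

/-! ### Explicit moments of single-power profiles -/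

lemma image_exp_neg_Ioi_zero : (fun x : ℝ => Real.exp (-x)) '' Ioi 0 = Ioo 0 1 := by
  ext y
  simp only [mem_image, mem_Ioi, mem_Ioo]
  constructor
  · rintro ⟨x, hx, rfl⟩
    exact ⟨Real.exp_pos _, by simpa using hx⟩
  · rintro ⟨h0, h1⟩
    exact ⟨-Real.log y, by simpa using Real.log_neg h0 h1, by rw [neg_neg, Real.exp_log h0]⟩

/-- The integrand vanishes for t ≥ 1; on (0, 1) the substitution t = exp(-x) gives a Gamma integral.
-/
lemma integral_rpow_mul_logMinus_rpow {d : ℕ} (hd : 1 ≤ d) {r a : ℝ} (hr : 0 < r) (ha : 0 < a) :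
    IntegrableOn (fun t : ℝ => t ^ (r - 1) * (1 / (d.factorial : ℝ) * logMinus (t ^ a) ^ d))
      (Ioi 0) ∧
    ∫ t in Ioi (0 : ℝ), t ^ (r - 1) * (1 / (d.factorial : ℝ) * logMinus (t ^ a) ^ d) =
      a ^ d / r ^ (d + 1) := by
  set F : ℝ → ℝ := fun t => t ^ (r - 1) * (1 / (d.factorial : ℝ) * logMinus (t ^ a) ^ d) with hF
  have hzero : ∀ t ∈ Ioi (0 : ℝ) \ Ioo 0 1, F t = 0 := by
    rintro t ⟨ht, ht'⟩
    have h1 : 1 ≤ t := by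
      by_contra! h
      exact ht' ⟨ht, h⟩
    simp only [hF]
    rw [logMinus_of_one_le (Real.one_le_rpow h1 ha.le), zero_pow (by omega), mul_zero, mul_zero]
  have hderiv : ∀ x ∈ Ioi (0 : ℝ),
      HasDerivWithinAt (fun x : ℝ => Real.exp (-x)) (-Real.exp (-x)) (Ioi 0) x := by
    intro x _
    simpa using (hasDerivAt_neg x).exp.hasDerivWithinAt
  have hinj : InjOn (fun x : ℝ => Real.exp (-x)) (Ioi 0) := fun x _ y _ h => by simpa using h
  have hcomp : ∀ x ∈ Ioi (0 : ℝ), |-Real.exp (-x)| • F (Real.exp (-x)) =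
      -- The exponent (d + 1) - 1 is left unsimplified to match the Gamma integral formula.
      a ^ d / d.factorial * (x ^ (((d : ℝ) + 1) - 1) * Real.exp (-(r * x))) := by
    intro x hx
    have hx' : 0 < x := hx
    have e1 : logMinus (Real.exp (-x) ^ a) = a * x := by
      rw [← Real.exp_mul, logMinus, Real.log_exp, max_eq_left (by nlinarith)]
      ring
    have e2 : Real.exp (-(r * x)) = Real.exp (-x) * Real.exp (-x) ^ (r - 1) := by
      rw [← Real.exp_mul, ← Real.exp_add]; congr 1; ring
    simp only [hF]
    rw [abs_neg, abs_of_pos (Real.exp_pos _), smul_eq_mul, e1, e2, add_sub_cancel_right,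
      Real.rpow_natCast]
    ring
  have hint : IntegrableOn F (Ioo 0 1) := by
    rw [← image_exp_neg_Ioi_zero,
      integrableOn_image_iff_integrableOn_abs_deriv_smul measurableSet_Ioi hderiv hinj,
      integrableOn_congr_fun hcomp measurableSet_Ioi]
    refine Integrable.const_mul ?_ _
    have := integrableOn_rpow_mul_exp_neg_mul_rpow (p := 1) (s := (d : ℝ) + 1 - 1) (b := r)
      (by have : (0 : ℝ) ≤ d := by positivity
          linarith) one_pos hr
    simpa [IntegrableOn] using this
  refine ⟨hint.of_forall_sdiff_eq_zero measurableSet_Ioi hzero, ?_⟩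
  rw [setIntegral_eq_of_subset_of_forall_sdiff_eq_zero measurableSet_Ioi Ioo_subset_Ioi_self hzero,
    ← image_exp_neg_Ioi_zero,
    integral_image_eq_integral_abs_deriv_smul measurableSet_Ioi hderiv hinj,
    setIntegral_congr_fun measurableSet_Ioi hcomp, integral_const_mul,
    Real.integral_rpow_mul_exp_neg_mul_Ioi (by positivity) hr, Real.Gamma_nat_eq_factorial]
  have h1 : (d.factorial : ℝ) ≠ 0 := by positivity
  have h2 : (1 / r) ^ ((d : ℝ) + 1) = (1 / r) ^ (d + 1) := by
    rw [← Real.rpow_natCast]; push_cast; rfl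
  rw [h2, one_div, inv_pow]
  field_simp

/-! ### The family with multipliers (1 - θ, θ) and its dilations -/

section UnitSupport

variable {d : ℕ} {p q r θ : ℝ}

lemma unit_combination_bounds (hθ : θ ∈ Icc (0 : ℝ) 1) {t : ℝ}
    (h0 : 0 < t) (h1 : t ≤ 1) :
    t ^ (max p q - 1) ≤ (1 - θ) * t ^ (p - 1) + θ * t ^ (q - 1) ∧
      (1 - θ) * t ^ (p - 1) + θ * t ^ (q - 1) ≤ t ^ (min p q - 1) := by
  have := Real.rpow_le_rpow_of_exponent_ge h0 h1 (sub_le_sub_right (le_max_left p q) 1)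
  have := Real.rpow_le_rpow_of_exponent_ge h0 h1 (sub_le_sub_right (le_max_right p q) 1)
  have := Real.rpow_le_rpow_of_exponent_ge h0 h1 (sub_le_sub_right (min_le_left p q) 1)
  have := Real.rpow_le_rpow_of_exponent_ge h0 h1 (sub_le_sub_right (min_le_right p q) 1)
  constructor <;> nlinarith [hθ.1, hθ.2]

lemma one_le_unit_combination (hp : 1 < p) (hq : 1 < q) (hθ : θ ∈ Icc (0 : ℝ) 1) {t : ℝ}
    (h1 : 1 ≤ t) : 1 ≤ (1 - θ) * t ^ (p - 1) + θ * t ^ (q - 1) := by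
  have := Real.one_le_rpow h1 (by linarith : 0 ≤ p - 1)
  have := Real.one_le_rpow h1 (by linarith : 0 ≤ q - 1)
  nlinarith [hθ.1, hθ.2]

/-- The single-power bounds do not depend on θ: the upper one dominates for continuity in θ, the
lower one gives positivity of the moments. -/
lemma unit_profile_bounds (hd : 1 ≤ d) (hp : 1 < p) (hq : 1 < q) (hθ : θ ∈ Icc (0 : ℝ) 1) {t : ℝ}
    (h0 : 0 < t) :
    1 / (d.factorial : ℝ) * logMinus (t ^ (min p q - 1)) ^ d ≤ profile d p q (1 - θ) θ t ∧
      profile d p q (1 - θ) θ t ≤ 1 / (d.factorial : ℝ) * logMinus (t ^ (max p q - 1)) ^ d := by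
  have hd' : d ≠ 0 := by omega
  unfold profile
  rcases le_total t 1 with h1 | h1
  · have hb := unit_combination_bounds (p := p) (q := q) hθ h0 h1
    have hpos : 0 < t ^ (max p q - 1) := by positivity
    constructor
    · gcongr
      · exact logMinus_nonneg _
      · exact logMinus_le_logMinus (hpos.trans_le hb.1) hb.2
    · gcongr
      · exact logMinus_nonneg _
      · exact logMinus_le_logMinus hpos hb.1
  · have hmin : 0 ≤ min p q - 1 := sub_nonneg.2 (le_min hp.le hq.le)
    have hmax : 0 ≤ max p q - 1 := sub_nonneg.2 (le_max_of_le_left hp.le)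
    rw [logMinus_of_one_le (one_le_unit_combination hp hq hθ h1),
      logMinus_of_one_le (Real.one_le_rpow h1 hmin), logMinus_of_one_le (Real.one_le_rpow h1 hmax)]
    simp

/-- `∫ t^{r-1} u(t) dt` for the profile `u` with multipliers `(1 - θ, θ)`, which vanishes exactly
on `[1, ∞)`. -/
noncomputable def unitMoment (d : ℕ) (p q r θ : ℝ) : ℝ :=
  ∫ t in Ioi (0 : ℝ), t ^ (r - 1) * profile d p q (1 - θ) θ t

lemma norm_weight_mul_unit_profile_le (hd : 1 ≤ d) (hp : 1 < p) (hq : 1 < q)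
    (hθ : θ ∈ Icc (0 : ℝ) 1) :
    ∀ᵐ t ∂volume.restrict (Ioi (0 : ℝ)), ‖t ^ (r - 1) * profile d p q (1 - θ) θ t‖ ≤
      t ^ (r - 1) * (1 / (d.factorial : ℝ) * logMinus (t ^ (max p q - 1)) ^ d) := by
  filter_upwards [ae_restrict_mem measurableSet_Ioi] with t ht
  have ht' : 0 < t := ht
  rw [Real.norm_of_nonneg (mul_nonneg (by positivity) (profile_nonneg t))]
  have := (unit_profile_bounds hd hp hq hθ ht).2
  gcongr

lemma measurable_weight_mul_profile {l₁ l₂ : ℝ} :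
    Measurable fun t : ℝ => t ^ (r - 1) * profile d p q l₁ l₂ t :=
  (by fun_prop : Measurable fun t : ℝ => t ^ (r - 1)).mul measurable_profile

lemma integrableOn_weight_mul_unit_profile (hd : 1 ≤ d) (hp : 1 < p) (hq : 1 < q) (hr : 0 < r)
    (hθ : θ ∈ Icc (0 : ℝ) 1) :
    IntegrableOn (fun t : ℝ => t ^ (r - 1) * profile d p q (1 - θ) θ t) (Ioi 0) :=
  Integrable.mono'
    (integral_rpow_mul_logMinus_rpow hd hr (sub_pos.2 (lt_max_of_lt_left hp))).1
    measurable_weight_mul_profile.aestronglyMeasurable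
    (norm_weight_mul_unit_profile_le hd hp hq hθ)

lemma unitMoment_pos (hd : 1 ≤ d) (hp : 1 < p) (hq : 1 < q) (hr : 0 < r)
    (hθ : θ ∈ Icc (0 : ℝ) 1) : 0 < unitMoment d p q r θ := by
  have hmin : 0 < min p q - 1 := sub_pos.2 (lt_min hp hq)
  have h := integral_rpow_mul_logMinus_rpow (d := d) hd hr hmin
  refine (by positivity : 0 < (min p q - 1) ^ d / r ^ (d + 1)).trans_le ?_
  rw [← h.2]
  refine setIntegral_mono_on h.1 (integrableOn_weight_mul_unit_profile hd hp hq hr hθ)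
    measurableSet_Ioi fun t ht => ?_
  have ht' : 0 < t := ht
  have := (unit_profile_bounds hd hp hq hθ ht).1
  gcongr

lemma continuousOn_unitMoment (hd : 1 ≤ d) (hp : 1 < p) (hq : 1 < q) (hr : 0 < r) :
    ContinuousOn (unitMoment d p q r) (Icc 0 1) := by
  refine continuousOn_of_dominated
    (fun θ _ => measurable_weight_mul_profile.aestronglyMeasurable)
    (fun θ hθ => norm_weight_mul_unit_profile_le hd hp hq hθ)
    (integral_rpow_mul_logMinus_rpow hd hr (sub_pos.2 (lt_max_of_lt_left hp))).1 ?_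
  filter_upwards [ae_restrict_mem measurableSet_Ioi] with t ht
  have ht' : 0 < t := ht
  unfold profile logMinus
  have hlog : ContinuousOn (fun θ : ℝ => Real.log ((1 - θ) * t ^ (p - 1) + θ * t ^ (q - 1)))
      (Icc 0 1) := by
    refine ContinuousOn.log (by fun_prop) fun θ hθ => ne_of_gt ?_
    have h1 : 0 < t ^ (p - 1) := by positivity
    have h2 : 0 < t ^ (q - 1) := by positivity
    rcases hθ.1.eq_or_lt with h | h
    · rw [← h]; simpa using h1
    · nlinarith [hθ.2, mul_pos h h2, mul_nonneg (sub_nonneg.2 hθ.2) h1.le]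
  exact continuousOn_const.mul
    (continuousOn_const.mul ((hlog.neg.sup continuousOn_const).pow d))

lemma unitMoment_zero (hd : 1 ≤ d) (hp : 1 < p) (hr : 0 < r) :
    unitMoment d p q r 0 = (p - 1) ^ d / r ^ (d + 1) := by
  rw [← (integral_rpow_mul_logMinus_rpow hd hr (sub_pos.2 hp)).2]
  simp [unitMoment, profile]

lemma unitMoment_one (hd : 1 ≤ d) (hq : 1 < q) (hr : 0 < r) :
    unitMoment d p q r 1 = (q - 1) ^ d / r ^ (d + 1) := by
  rw [← (integral_rpow_mul_logMinus_rpow hd hr (sub_pos.2 hq)).2]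
  simp [unitMoment, profile]

/-- The dilation by `s` of the profile with multipliers `(1 - θ, θ)` is again a profile. -/
lemma profile_dilation {s t : ℝ} (hs : 0 < s) (ht : 0 < t) :
    profile d p q (s⁻¹ ^ (p - 1) * (1 - θ)) (s⁻¹ ^ (q - 1) * θ) t =
      profile d p q (1 - θ) θ (s⁻¹ * t) := by
  unfold profile
  rw [Real.mul_rpow (by positivity) ht.le, Real.mul_rpow (by positivity) ht.le]
  congr 3
  ring

lemma weight_mul_profile_dilation {s t : ℝ} (hs : 0 < s) (ht : 0 < t) :
    t ^ (r - 1) * profile d p q (s⁻¹ ^ (p - 1) * (1 - θ)) (s⁻¹ ^ (q - 1) * θ) t =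
      s ^ (r - 1) * ((s⁻¹ * t) ^ (r - 1) * profile d p q (1 - θ) θ (s⁻¹ * t)) := by
  rw [profile_dilation hs ht, ← mul_assoc, ← Real.mul_rpow hs.le (by positivity),
    mul_inv_cancel_left₀ hs.ne']

lemma moment_profile_dilation (hd : 1 ≤ d) (hp : 1 < p) (hq : 1 < q) (hr : 0 < r)
    (hθ : θ ∈ Icc (0 : ℝ) 1) {s : ℝ} (hs : 0 < s) :
    moment r (profile d p q (s⁻¹ ^ (p - 1) * (1 - θ)) (s⁻¹ ^ (q - 1) * θ)) =
      ENNReal.ofReal (s ^ r * (r * unitMoment d p q r θ)) := by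
  set F : ℝ → ℝ := fun t => t ^ (r - 1) * profile d p q (1 - θ) θ t with hF
  have hi : IntegrableOn (fun t => s ^ (r - 1) * F (s⁻¹ * t)) (Ioi 0) := by
    refine Integrable.const_mul ?_ _
    have := (integrableOn_Ioi_comp_mul_left_iff F 0 (inv_pos.2 hs)).2
      (by rw [mul_zero]; exact integrableOn_weight_mul_unit_profile hd hp hq hr hθ)
    exact this
  have hval : ∫ t in Ioi (0 : ℝ), s ^ (r - 1) * F (s⁻¹ * t) = s ^ r * unitMoment d p q r θ := by
    rw [integral_const_mul, integral_comp_mul_left_Ioi _ _ (inv_pos.2 hs), mul_zero, inv_inv,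
      smul_eq_mul, ← mul_assoc, ← Real.rpow_add_one hs.ne', sub_add_cancel]
    rfl
  have hl : ∫⁻ t in Ioi (0 : ℝ), ENNReal.ofReal
      (t ^ (r - 1) * profile d p q (s⁻¹ ^ (p - 1) * (1 - θ)) (s⁻¹ ^ (q - 1) * θ) t) =
      ∫⁻ t in Ioi (0 : ℝ), ENNReal.ofReal (s ^ (r - 1) * F (s⁻¹ * t)) :=
    setLIntegral_congr_fun measurableSet_Ioi fun t ht => by
      rw [weight_mul_profile_dilation hs ht]
  rw [moment, hl, ← ofReal_integral_eq_lintegral_ofReal hi, hval, ← ENNReal.ofReal_mul hr.le]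
  · congr 1; ring
  · filter_upwards [ae_restrict_mem measurableSet_Ioi] with t ht
    have ht' : 0 < t := ht
    exact mul_nonneg (by positivity) (mul_nonneg (by positivity) (profile_nonneg _))

end UnitSupport

/-! ### Existence of the multipliers -/

/-- Used with (a, b) = (p, q) at θ = 0 and, inverted, with (q, p) at θ = 1. -/
lemma kappa_ratio_eq {d : ℕ} {a b : ℝ} (ha : 1 < a) (hb : 1 < b) :
    (b * ((a - 1) ^ d / b ^ (d + 1))) ^ (1 / b) / (a * ((a - 1) ^ d / a ^ (d + 1))) ^ (1 / a) =
      kappa a ^ ((d : ℝ) * (1 / b - 1 / a)) * (a / b) ^ ((d : ℝ) / b) := by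
  have ha0 : 0 < a := by linarith
  have hb0 : 0 < b := by linarith
  have hk : 0 < kappa a := div_pos (by linarith) ha0
  have hab : 0 < a / b := by positivity
  have e1 : b * ((a - 1) ^ d / b ^ (d + 1)) = (kappa a * (a / b)) ^ (d : ℝ) := by
    rw [Real.rpow_natCast, kappa, div_mul_div_cancel₀ ha0.ne', div_pow]
    field_simp
    ring
  have e2 : a * ((a - 1) ^ d / a ^ (d + 1)) = kappa a ^ (d : ℝ) := by
    rw [Real.rpow_natCast, kappa, div_pow]
    field_simp
    ring
  rw [e1, e2, ← Real.rpow_mul (by positivity), ← Real.rpow_mul hk.le,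
    Real.mul_rpow hk.le hab.le, mul_div_right_comm, ← Real.rpow_sub hk]
  congr 2 <;> ring

lemma IntermediateRegime.ne {d : ℕ} {p q A B : ℝ}
    (h : IntermediateRegime d p q A B) : p ≠ q := by
  rintro rfl
  have := h.1.trans h.2
  simp at this

lemma exists_saturating_profile {d : ℕ} (hd : 1 ≤ d) {p q A B : ℝ} (hp : 1 < p) (hq : 1 < q)
    (hA : 0 < A) (hB : 0 < B) (hreg : IntermediateRegime d p q A B) :
    ∃ l₁ l₂ : ℝ, 0 < l₁ ∧ 0 < l₂ ∧ SaturatesConstraints p q A B (profile d p q l₁ l₂) ∧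
      moment 1 (profile d p q l₁ l₂) ≠ ⊤ := by
  have hp0 : 0 < p := by linarith
  have hq0 : 0 < q := by linarith
  have hpos : ∀ {r θ : ℝ}, 0 < r → θ ∈ Icc (0 : ℝ) 1 → 0 < r * unitMoment d p q r θ :=
    fun hr hθ => mul_pos hr (unitMoment_pos hd hp hq hr hθ)
  set R : ℝ → ℝ := fun θ => (q * unitMoment d p q q θ) ^ (1 / q) /
    (p * unitMoment d p q p θ) ^ (1 / p) with hR
  have hcont : ContinuousOn R (Icc 0 1) :=
    ((continuousOn_const.mul (continuousOn_unitMoment hd hp hq hq0)).rpow_const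
      fun θ hθ => Or.inl (hpos hq0 hθ).ne').div
    ((continuousOn_const.mul (continuousOn_unitMoment hd hp hq hp0)).rpow_const
      fun θ hθ => Or.inl (hpos hp0 hθ).ne')
    fun θ hθ => (Real.rpow_pos_of_pos (hpos hp0 hθ) _).ne'
  have hR0 : B / A < R 0 := by
    simp only [hR]
    rw [unitMoment_zero hd hp hp0, unitMoment_zero hd hp hq0, kappa_ratio_eq hp hq]
    exact hreg.2
  have hR1 : R 1 < B / A := by
    refine lt_of_eq_of_lt ?_ hreg.1
    have hkq : 0 < kappa q := div_pos (by linarith) hq0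
    simp only [hR]
    rw [unitMoment_one hd hq hp0, unitMoment_one hd hq hq0, ← inv_div, kappa_ratio_eq hq hp,
      mul_inv, ← Real.rpow_neg hkq.le, ← Real.inv_rpow (by positivity), inv_div]
    congr 2
    ring
  obtain ⟨θ, hθ, hRθ⟩ := intermediate_value_Icc' zero_le_one hcont ⟨hR1.le, hR0.le⟩
  -- Strictness of the regime excludes the endpoints, which makes both multipliers positive.
  have hθ0 : 0 < θ := hθ.1.lt_of_ne fun h => by rw [← h] at hRθ; exact hR0.ne' hRθ
  have hθ1 : θ < 1 := hθ.2.lt_of_ne fun h => by rw [h] at hRθ; exact hR1.ne hRθ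
  have hP := hpos hp0 hθ
  have hQ := hpos hq0 hθ
  set P := p * unitMoment d p q p θ with hPdef
  set Q := q * unitMoment d p q q θ with hQdef
  have hP' : 0 < P ^ (1 / p) := by positivity
  have hRθ : Q ^ (1 / q) / P ^ (1 / p) = B / A := hRθ
  -- This dilation factor is forced by the p-constraint; the ratio equation makes it equal to B /
  -- Q^(1/q), as the q-constraint needs.
  have hs : 0 < A / P ^ (1 / p) := by positivity
  refine ⟨(A / P ^ (1 / p))⁻¹ ^ (p - 1) * (1 - θ), (A / P ^ (1 / p))⁻¹ ^ (q - 1) * θ,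
    mul_pos (by positivity) (by linarith), by positivity, ⟨?_, ?_⟩, ?_⟩
  · rw [moment_profile_dilation hd hp hq hp0 hθ hs, ← hPdef, Real.div_rpow hA.le hP'.le,
      ← Real.rpow_mul hP.le, one_div_mul_cancel hp0.ne', Real.rpow_one, div_mul_cancel₀ _ hP.ne']
  · have e : A / P ^ (1 / p) = B / Q ^ (1 / q) := by
      have : 0 < Q ^ (1 / q) := by positivity
      field_simp at hRθ ⊢
      linarith
    rw [moment_profile_dilation hd hp hq hq0 hθ hs, ← hQdef, e, Real.div_rpow hB.le (by positivity),
      ← Real.rpow_mul hQ.le, one_div_mul_cancel hq0.ne', Real.rpow_one, div_mul_cancel₀ _ hQ.ne']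
  · rw [moment_profile_dilation hd hp hq one_pos hθ hs]
    exact ENNReal.ofReal_ne_top

/-! ### Finiteness of the supremum -/

lemma G_le_self {d : ℕ} (hd : 1 ≤ d) {s : ℝ} (hs : 0 ≤ s) : G d s ≤ s := by
  rcases hs.eq_or_lt with h | h
  · rw [← h, G_zero]
  · have := G_lt_tangent hd le_rfl hs h.ne'
    rw [G_zero, density_zero hd] at this
    linarith

/-- Applied to the maximizing profile, whose first moment is finite. -/
lemma I_le_moment_one {d : ℕ} (hd : 1 ≤ d) {v : ℝ → ℝ} (h0 : ∀ t ∈ Ioi (0 : ℝ), 0 ≤ v t) :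
    I d v ≤ moment 1 v := by
  rw [moment, ENNReal.ofReal_one, one_mul]
  refine setLIntegral_mono' measurableSet_Ioi fun t ht => ENNReal.ofReal_le_ofReal ?_
  rw [sub_self, Real.rpow_zero, one_mul]
  exact G_le_self hd (h0 t ht)

end TwoConstraint

open TwoConstraint in
theorem mainTheorem5 (d : ℕ) (hd : 1 ≤ d) (p q A B : ℝ) (hp : 1 < p) (hq : 1 < q)
    (hA : 0 < A) (hB : 0 < B) (hreg : TwoConstraint.IntermediateRegime d p q A B) :
    (⨆ w ∈ TwoConstraint.admissible p q A B, TwoConstraint.I d w) < ⊤ ∧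
    ∃ l₁ l₂ : ℝ, 0 < l₁ ∧ 0 < l₂ ∧
      TwoConstraint.SaturatesConstraints p q A B (TwoConstraint.profile d p q l₁ l₂) ∧
      (∀ m₁ m₂ : ℝ, 0 < m₁ → 0 < m₂ →
        TwoConstraint.SaturatesConstraints p q A B (TwoConstraint.profile d p q m₁ m₂) →
          m₁ = l₁ ∧ m₂ = l₂) ∧
      (∀ u : ℝ → ℝ, TwoConstraint.IsMaximizer d p q A B u ↔
        Set.EqOn u (TwoConstraint.profile d p q l₁ l₂) (Set.Ioi 0)) := by
  obtain ⟨l₁, l₂, h₁, h₂, hs, hint⟩ := exists_saturating_profile hd hp hq hA hB hreg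
  have hmax := isMaximizer_profile hd hp hq h₁ h₂ hs
  have hfin : (⨆ w ∈ admissible p q A B, I d w) < ⊤ := by
    rw [← hmax.2]
    exact (I_le_moment_one hd fun t _ => profile_nonneg t).trans_lt hint.lt_top
  have huniq : ∀ u, IsMaximizer d p q A B u → Set.EqOn u (profile d p q l₁ l₂) (Set.Ioi 0) :=
    fun u hu => hu.eqOn_profile hd hp hq h₁ h₂ hs hfin.ne
  exact ⟨hfin, l₁, l₂, h₁, h₂, hs,
    fun m₁ m₂ hm₁ hm₂ hm => eq_of_eqOn_profile hd hp hq hreg.ne h₁ h₂ hm₁ hm₂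
      (huniq _ (isMaximizer_profile hd hp hq hm₁ hm₂ hm)),
    fun u => ⟨huniq u, hmax.congr⟩⟩
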